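/- Let $\mathcal{A}$ and $\mathcal{B}$ be abelian categories with enough projective objects. Let $F\colon\mathcal{A}\to\mathcal{B}$ and $G\colon\mathcal{B}\to\mathcal{A}$ be additive functors forming a Frobenius pair, that is, there are autoequivalences $\alpha$ of $\mathcal{A}$ and $\beta$ of $\mathcal{B}$ such that both $(F,G)$ and $(G,\beta F\alpha)$ are adjoint pairs; then $F$ and $G$ are exact and preserve projective objects. Let $\eta\colon \mathrm{Id}_{\mathcal{A}}\to GF$ and $\varepsilon\colon FG\to \mathrm{Id}_{\mathcal{B}}$ be the unit and the counit of $(F,G)$. An object of $\mathcal{A}$ is Gorenstein projective if it is isomorphic to the zeroth cocycle object of an acyclic complex of projective objects which remains acyclic after applying $\mathrm{Hom}_{\mathcal{A}}(-,Q)$ for every projective $Q$. Denote by $\underline{\mathcal{GP}}(\mathcal{A})$ the stable category of Gorenstein projective objects (morphisms modulo those factoring through projective objects), with its triangulated structure as the stable category of a Frobenius exact category, in which the distinguished triangles are those isomorphic to the triangles arising from short exact sequences of Gorenstein projective objects. Inside the bounded derived category $\mathbf{D}^b(\mathcal{A})$, let $\mathbf{K}^b(\mathcal{P}(\mathcal{A}))$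 and $\mathbf{D}^b(\mathcal{A})_{\rm fGd}$ be the full subcategories of objects isomorphic to bounded complexes of projective, respectively Gorenstein projective, objects. The singularity category and the Gorenstein defect category are the Verdier quotients $$\mathbf{D}_{\rm sg}(\mathcal{A})=\mathbf{D}^b(\mathcal{A})/\mathbf{K}^b(\mathcal{P}(\mathcal{A})),\qquad \mathbf{D}_{\rm def}(\mathcal{A})=\mathbf{D}^b(\mathcal{A})/\mathbf{D}^b(\mathcal{A})_{\rm fGd}.$$ Assume that $F$ and $G$ are faithful, and that $\mathrm{Cok}(\eta_X)$ and $\mathrm{Ker}(\varepsilon_Y)$ are projective for all $X\in\mathcal{A}$ and $Y\in\mathcal{B}$. Then $F$ and $G$ induce mutually quasi-inverse triangle equivalences $$\underline{\mathcal{GP}}(\mathcal{A})\simeq\underline{\mathcal{GP}}(\mathcal{B}),\qquad \mathbf{D}_{\rm sg}(\mathcal{A})\simeq\mathbf{D}_{\rm sg}(\mathcal{B}),\qquad \mathbf{D}_{\rm def}(\mathcal{A})\simeq\mathbf{D}_{\rm def}(\mathcal{B}),$$ that is, each equivalence and its quasi-inverse are triangle functors which commute, up to natural isomorphism, with the quotient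 functors and with the functors that $F$ and $G$ induce on Gorenstein projective objects, respectively on bounded derived categories. -/

import Mathlib

open CategoryTheory Category Limits Pretriangulated

universe w₁ w₂ v₁ v₂ u₁ u₂

noncomputable section

namespace FrobeniusGorenstein

/-! ### Triangle functors -/

/-- The data underlying a triangulated category: a suspension functor and a class of
distinguished triangles `X ⟶ Y ⟶ Z ⟶ ΣX`. It is only used below for the stable category of
Gorenstein projective objects and for Verdier quotients of the bounded derived category. -/
structure TriangleStructure (C : Type u₁) [Category.{v₁} C] where
  /-- the suspension functor `Σ` -/
  susp : C ⥤ C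
  /-- the distinguished triangles -/
  distinguished : ∀ {X Y Z : C}, (X ⟶ Y) → (Y ⟶ Z) → (Z ⟶ susp.obj X) → Prop

section

variable {C : Type u₁} [Category.{v₁} C] {D : Type u₂} [Category.{v₂} D]

/-- `Φ` is a triangle functor: there is a natural isomorphism `θ : Φ Σ ≅ Σ Φ` such that
`Φ X ⟶ Φ Y ⟶ Φ Z ⟶ Φ ΣX ≅ Σ ΦX` is distinguished whenever `X ⟶ Y ⟶ Z ⟶ ΣX` is. -/
def IsTriangleFunctor (S : TriangleStructure C) (T : TriangleStructure D) (Φ : C ⥤ D) : Prop :=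
  ∃ θ : S.susp ⋙ Φ ≅ Φ ⋙ T.susp,
    ∀ ⦃X Y Z : C⦄ (f : X ⟶ Y) (g : Y ⟶ Z) (h : Z ⟶ S.susp.obj X),
      S.distinguished f g h →
        T.distinguished (Φ.map f) (Φ.map g) (Φ.map h ≫ θ.hom.app X)

end

/-- Let `L : C ⥤ C'` and `M : D ⥤ D'` be quotient functors. The functors `Φ : C ⥤ D` and
`Γ : D ⥤ C` induce mutually quasi-inverse triangle equivalences between `C'` and `D'`. -/
def InduceTriangleEquivalence {C C' D D' : Type*} [Category* C] [Category* C'] [Category* D]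
    [Category* D'] (L : C ⥤ C') (M : D ⥤ D')
    (S : TriangleStructure C') (T : TriangleStructure D') (Φ : C ⥤ D) (Γ : D ⥤ C) : Prop :=
  ∃ E : C' ≌ D',
    Nonempty (L ⋙ E.functor ≅ Φ ⋙ M) ∧ Nonempty (M ⋙ E.inverse ≅ Γ ⋙ L) ∧
    IsTriangleFunctor S T E.functor ∧ IsTriangleFunctor T S E.inverse

/-! ### Gorenstein projective objects -/

section

variable {A : Type u₁} [Category.{v₁} A] [Abelian A]

/-- A totally acyclic complex: an acyclic complex of projective objects which remains acyclic
under `Hom(-, Q)` for every projective object `Q`. -/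
structure IsTotallyAcyclic (P : CochainComplex A ℤ) : Prop where
  projective : ∀ n, Projective (P.X n)
  acyclic : P.Acyclic
  /-- exactness of `Hom(P.X k, Q) ⟶ Hom(P.X j, Q) ⟶ Hom(P.X i, Q)` -/
  hom_exact : ∀ (i j k : ℤ), i + 1 = j → j + 1 = k → ∀ (Q : A), Projective Q →
    ∀ f : P.X j ⟶ Q, P.d i j ≫ f = 0 → ∃ g : P.X k ⟶ Q, P.d j k ≫ g = f

variable (A) in
/-- Gorenstein projective objects: those isomorphic to the zeroth cocycle object of a totally
acyclic complex. -/
def gorensteinProjective : ObjectProperty A := fun M =>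
  ∃ P : CochainComplex A ℤ, IsTotallyAcyclic P ∧ Nonempty (M ≅ P.cycles 0)

variable (A) in
/-- The full subcategory of Gorenstein projective objects. -/
abbrev GP := (gorensteinProjective A).FullSubcategory

lemma IsTotallyAcyclic.shift_one {P : CochainComplex A ℤ} (hP : IsTotallyAcyclic P) :
    IsTotallyAcyclic (P⟦(1 : ℤ)⟧) where
  projective n := hP.projective (n + 1)
  acyclic n := by
    have h := hP.acyclic (1 + n)
    rw [HomologicalComplex.exactAt_iff] at h ⊢
    exact ShortComplex.exact_of_iso
      ((CochainComplex.shiftShortComplexFunctorIso A 1 n (1 + n) rfl).symm.app P) h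
  hom_exact i j k hij hjk Q hQ := by
    have key : ∀ f : P.X (j + 1) ⟶ Q,
        ((1 : ℤ).negOnePow • P.d (i + 1) (j + 1)) ≫ f = 0 →
          ∃ g : P.X (k + 1) ⟶ Q, ((1 : ℤ).negOnePow • P.d (j + 1) (k + 1)) ≫ g = f := by
      intro f hf
      obtain ⟨g, hg⟩ := hP.hom_exact (i + 1) (j + 1) (k + 1) (by lia) (by lia) Q hQ f
        (by simpa using hf)
      exact ⟨-g, by simpa using hg⟩
    exact key

lemma IsTotallyAcyclic.cycles_one {P : CochainComplex A ℤ} (hP : IsTotallyAcyclic P) :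
    gorensteinProjective A (P.cycles 1) :=
  ⟨_, hP.shift_one,
    ⟨(ShortComplex.cyclesFunctor A).mapIso
      ((CochainComplex.shiftShortComplexFunctorIso A 1 0 1 rfl).symm.app P)⟩⟩

/-- A conflation `0 ⟶ X ⟶ I ⟶ S ⟶ 0` of Gorenstein projective objects with `I` projective.
Projective objects are also injective for such conflations; this is recorded in `extend`. -/
structure Hull (X : GP A) where
  I : A
  S : GP A
  i : X.obj ⟶ I
  p : I ⟶ S.obj
  zero : i ≫ p = 0
  projective : Projective I
  shortExact : (ShortComplex.mk i p zero).ShortExact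
  extend : ∀ (Q : A), Projective Q → ∀ f : X.obj ⟶ Q, ∃ g : I ⟶ Q, i ≫ g = f

lemma nonempty_hull (X : GP A) : Nonempty (Hull X) := by
  obtain ⟨P, hP, ⟨e⟩⟩ := X.property
  have hT : ∀ (m n : ℤ), m + 1 = n → Epi (P.toCycles m n) := by
    rintro m n rfl
    have h := (hP.acyclic (m + 1)).isZero_homology
    rw [Preadditive.epi_iff_cancel_zero]
    intro T f hf
    have hm : (ComplexShape.up ℤ).prev (m + 1) = m := by simp
    have hc := P.homologyIsCokernel m (m + 1) hm
    obtain ⟨g, hg⟩ : ∃ g, P.homologyπ (m + 1) ≫ g = f :=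
      ⟨_, (CokernelCofork.IsColimit.desc' hc f hf).2⟩
    rw [← hg, h.eq_of_src g 0, comp_zero]
  have zero : (e.hom ≫ P.iCycles 0) ≫ P.toCycles 0 1 = 0 := by
    rw [← cancel_mono (P.iCycles 1)]
    simp
  refine ⟨⟨P.X 0, ⟨_, hP.cycles_one⟩, e.hom ≫ P.iCycles 0, P.toCycles 0 1, zero,
    hP.projective 0, ?_, ?_⟩⟩
  · have := hT 0 1 rfl
    refine ShortComplex.ShortExact.mk' (ShortComplex.exact_of_f_is_kernel _ ?_)
      (mono_comp _ _) this
    refine KernelFork.IsLimit.ofι' _ _ (fun {T} k hk => ?_)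
    have hk' : k ≫ P.d 0 1 = 0 := by
      rw [← P.toCycles_i 0 1, reassoc_of% hk, zero_comp]
    exact ⟨P.liftCycles k 1 (by simp) hk' ≫ e.inv, by simp⟩
  · intro Q hQ f
    have := hT (-1) 0 rfl
    obtain ⟨g, hg⟩ := hP.hom_exact (-2) (-1) 0 rfl rfl Q hQ
      (P.toCycles (-1) 0 ≫ e.inv ≫ f) (by simp)
    refine ⟨g, ?_⟩
    rw [← cancel_epi e.inv, ← cancel_epi (P.toCycles (-1) 0)]
    simpa using hg

/-- A chosen conflation `0 ⟶ X ⟶ I(X) ⟶ ΣX ⟶ 0`. -/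
def hull (X : GP A) : Hull X := (nonempty_hull X).some

/-! ### The stable category of Gorenstein projective objects -/

variable (A) in
/-- Two morphisms of Gorenstein projective objects are identified in the stable category if
their difference factors through a projective object. -/
def stableRel : HomRel (GP A) := fun X Y f g =>
  ∃ (Q : A) (_ : Projective Q) (a : X.obj ⟶ Q) (b : Q ⟶ Y.obj), f.hom - g.hom = a ≫ b

instance : Congruence (stableRel A) where
  equivalence {X Y} :=
    { refl := fun f => ⟨(hull X).I, (hull X).projective, 0, 0, by simp⟩
      symm := by
        rintro f g ⟨Q, hQ, a, b, h⟩
        exact ⟨Q, hQ, -a, b, by rw [Preadditive.neg_comp, ← h, neg_sub]⟩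
      trans := by
        rintro f g k ⟨Q, hQ, a, b, h⟩ ⟨Q', hQ', a', b', h'⟩
        refine ⟨Q ⊞ Q', inferInstance, biprod.lift a a', biprod.desc b b', ?_⟩
        rw [biprod.lift_desc, ← h, ← h', sub_add_sub_cancel] }
  comp_left f g g' := by
    rintro ⟨Q, hQ, a, b, h⟩
    exact ⟨Q, hQ, f.hom ≫ a, b, by simp [← h]⟩
  comp_right g := by
    rintro ⟨Q, hQ, a, b, h⟩
    exact ⟨Q, hQ, a, b ≫ g.hom, by rw [← assoc, ← h]; simp⟩

variable (A) in
/-- The stable category of Gorenstein projective objects. -/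
abbrev StableGP := CategoryTheory.Quotient (stableRel A)

variable (A) in
/-- The projection from Gorenstein projective objects to their stable category. -/
abbrev stableProj : GP A ⥤ StableGP A := CategoryTheory.Quotient.functor (stableRel A)

/-- `s : ΣX ⟶ ΣY` is induced by `f : X ⟶ Y`, via a morphism of the chosen conflations. -/
def IsSuspOf {X Y : GP A} (f : X ⟶ Y) (s : (hull X).S ⟶ (hull Y).S) : Prop :=
  ∃ t : (hull X).I ⟶ (hull Y).I,
    (hull X).i ≫ t = f.hom ≫ (hull Y).i ∧ (hull X).p ≫ s.hom = t ≫ (hull Y).p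

lemma exists_isSuspOf {X Y : GP A} (f : X ⟶ Y) : ∃ s, IsSuspOf f s := by
  obtain ⟨t, ht⟩ := (hull X).extend _ (hull Y).projective (f.hom ≫ (hull Y).i)
  have h : (hull X).i ≫ t ≫ (hull Y).p = 0 := by
    rw [← assoc, ht, assoc, (hull Y).zero, comp_zero]
  have := (hull X).shortExact.epi_g
  exact ⟨ObjectProperty.homMk ((hull X).shortExact.exact.desc (t ≫ (hull Y).p) h), t, ht,
    (hull X).shortExact.exact.g_desc _ h⟩

lemma IsSuspOf.stableRel {X Y : GP A} {f f' : X ⟶ Y} {s s' : (hull X).S ⟶ (hull Y).S}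
    (hs : IsSuspOf f s) (hs' : IsSuspOf f' s') (h : stableRel A f f') : stableRel A s s' := by
  obtain ⟨t, ht, hs⟩ := hs
  obtain ⟨t', ht', hs'⟩ := hs'
  obtain ⟨Q, hQ, a, b, h⟩ := h
  obtain ⟨a', rfl⟩ := (hull X).extend Q hQ a
  have := (hull X).shortExact.epi_g
  have hk : (hull X).i ≫ (t - t' - a' ≫ b ≫ (hull Y).i) = 0 := by
    rw [Preadditive.comp_sub, Preadditive.comp_sub, ht, ht', ← Preadditive.sub_comp, h]
    simp
  refine ⟨(hull Y).I, (hull Y).projective, (hull X).shortExact.exact.desc _ hk, (hull Y).p, ?_⟩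
  rw [← cancel_epi (hull X).p, ← assoc]
  erw [(hull X).shortExact.exact.g_desc _ hk]
  simp [hs, hs', (hull Y).zero]

/-- A choice of `Σf`, well defined in the stable category. -/
def suspMap {X Y : GP A} (f : X ⟶ Y) : (hull X).S ⟶ (hull Y).S := (exists_isSuspOf f).choose

lemma suspMap_spec {X Y : GP A} (f : X ⟶ Y) : IsSuspOf f (suspMap f) :=
  (exists_isSuspOf f).choose_spec

lemma suspMap_eq {X Y : GP A} {f : X ⟶ Y} {s : (hull X).S ⟶ (hull Y).S} (hs : IsSuspOf f s) :
    (stableProj A).map (suspMap f) = (stableProj A).map s :=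
  CategoryTheory.Quotient.sound _ ((suspMap_spec f).stableRel hs (Congruence.equivalence.refl f))

variable (A) in
/-- The suspension functor of the stable category. -/
def stableSusp : StableGP A ⥤ StableGP A :=
  CategoryTheory.Quotient.lift (stableRel A)
    { obj := fun X => (stableProj A).obj (hull X).S
      map := fun f => (stableProj A).map (suspMap f)
      map_id := fun X => by
        rw [suspMap_eq (s := 𝟙 _) ⟨𝟙 _, by simp, by simp⟩, CategoryTheory.Functor.map_id]
      map_comp := fun {X Y Z} f g => by
        obtain ⟨t, ht, hs⟩ := suspMap_spec f
        obtain ⟨t', ht', hs'⟩ := suspMap_spec g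
        rw [suspMap_eq (s := suspMap f ≫ suspMap g) ⟨t ≫ t', ?_, ?_⟩, CategoryTheory.Functor.map_comp]
        · rw [← assoc, ht, assoc, ht']
          simp
        · rw [ObjectProperty.FullSubcategory.comp_hom, ← assoc, hs, assoc, hs', assoc] }
    (fun _ _ f g h => CategoryTheory.Quotient.sound _ ((suspMap_spec f).stableRel (suspMap_spec g) h))

/-- The triangle `X ⟶ Y ⟶ Z ⟶ ΣX` (of morphisms of Gorenstein projective objects) attached to
a conflation `0 ⟶ X ⟶ Y ⟶ Z ⟶ 0`. If `t : Y ⟶ I(X)` extends `X ⟶ I(X)`, then the map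
`w : Z ⟶ ΣX` is minus the map induced by `t` on cokernels: with this sign the isomorphism
closure consists of the triangles given by the pushouts of `X ⟶ I(X)`. -/
structure IsStandardTriangle {X Y Z : GP A} (u : X ⟶ Y) (v : Y ⟶ Z) (w : Z ⟶ (hull X).S) :
    Prop where
  zero : u.hom ≫ v.hom = 0
  shortExact : (ShortComplex.mk u.hom v.hom zero).ShortExact
  connecting : ∃ t : Y.obj ⟶ (hull X).I,
    u.hom ≫ t = (hull X).i ∧ v.hom ≫ w.hom = -(t ≫ (hull X).p)

variable (A) in
/-- The triangulated structure of the stable category of the Frobenius exact category of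
Gorenstein projective objects: the distinguished triangles are those isomorphic to a triangle
attached to a conflation. -/
def stableTriangles : TriangleStructure (StableGP A) where
  susp := stableSusp A
  distinguished {X Y Z} f g h :=
    ∃ (X' Y' Z' : GP A) (u : X' ⟶ Y') (v : Y' ⟶ Z') (w : Z' ⟶ (hull X').S)
      (_ : IsStandardTriangle u v w)
      (a : X ≅ (stableProj A).obj X') (b : Y ≅ (stableProj A).obj Y')
      (c : Z ≅ (stableProj A).obj Z'),
      f ≫ b.hom = a.hom ≫ (stableProj A).map u ∧
      g ≫ c.hom = b.hom ≫ (stableProj A).map v ∧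
      h ≫ (stableSusp A).map a.hom = c.hom ≫ (stableProj A).map w

end

/-! ### Singularity category and Gorenstein defect category -/

section

variable (A : Type u₁) [Category.{v₁} A] [Abelian A] [HasDerivedCategory.{w₁} A]

/-- The objects of the bounded derived category isomorphic to a bounded complex with all
components in `S`. -/
def boundedComplexesIn (S : ObjectProperty A) : ObjectProperty (DerivedCategory.Bounded A) :=
  fun X => ∃ (K : CochainComplex A ℤ) (a b : ℤ), K.IsStrictlyGE a ∧ K.IsStrictlyLE b ∧
    (∀ n, S (K.X n)) ∧ Nonempty (X.obj ≅ DerivedCategory.Q.obj K)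

instance (S : ObjectProperty A) : (boundedComplexesIn A S).IsStableUnderShift ℤ where
  isStableUnderShiftBy n :=
    { le_shift := by
        rintro X ⟨K, a, b, ha, hb, hS, ⟨e⟩⟩
        exact ⟨K⟦n⟧, a - n, b - n, K.isStrictlyGE_shift a n (a - n) (by lia),
          K.isStrictlyLE_shift b n (b - n) (by lia), fun i => hS (i + n),
          ⟨(DerivedCategory.Bounded.ι.commShiftIso n).app X ≪≫
            (shiftFunctor (DerivedCategory A) n).mapIso e ≪≫
            (DerivedCategory.Q.commShiftIso n).symm.app K⟩⟩ }

/-- `K^b(P(A))`, viewed as a full subcategory of `D^b(A)`. -/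
abbrev perfect : ObjectProperty (DerivedCategory.Bounded A) :=
  boundedComplexesIn A (fun X => Projective X)

/-- `D^b(A)_fGd`: objects isomorphic to bounded complexes of Gorenstein projective objects. -/
abbrev finiteGdim : ObjectProperty (DerivedCategory.Bounded A) :=
  boundedComplexesIn A (gorensteinProjective A)

variable {A} in
/-- The Verdier quotient of `D^b(A)` by `N`: the localization at the morphisms whose cone
belongs to `N`. -/
abbrev VerdierQuotient (N : ObjectProperty (DerivedCategory.Bounded A)) := N.trW.Localization

variable {A} in
/-- The quotient functor. -/
abbrev verdierProj (N : ObjectProperty (DerivedCategory.Bounded A)) :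
    DerivedCategory.Bounded A ⥤ VerdierQuotient N := N.trW.Q

variable {A} in
/-- The triangulated structure of the Verdier quotient: the suspension is induced by the one of
`D^b(A)`, and the distinguished triangles are those isomorphic to the image of a distinguished
triangle of `D^b(A)`. -/
def verdierTriangles (N : ObjectProperty (DerivedCategory.Bounded A))
    [N.IsStableUnderShift ℤ] : TriangleStructure (VerdierQuotient N) where
  susp := shiftFunctor (VerdierQuotient N) (1 : ℤ)
  distinguished f g h := Triangle.mk f g h ∈ (verdierProj N).essImageDistTriang

/-- The singularity category `D_sg(A) = D^b(A) / K^b(P(A))`. -/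
abbrev SingularityCategory := VerdierQuotient (perfect A)

/-- The quotient functor `D^b(A) ⥤ D_sg(A)`. -/
abbrev singularityProj : DerivedCategory.Bounded A ⥤ SingularityCategory A :=
  verdierProj (perfect A)

/-- The triangulated structure of `D_sg(A)`. -/
abbrev singularityTriangles : TriangleStructure (SingularityCategory A) :=
  verdierTriangles (perfect A)

/-- The Gorenstein defect category `D_def(A) = D^b(A) / D^b(A)_fGd`. -/
abbrev DefectCategory := VerdierQuotient (finiteGdim A)

/-- The quotient functor `D^b(A) ⥤ D_def(A)`. -/
abbrev defectProj : DerivedCategory.Bounded A ⥤ DefectCategory A :=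
  verdierProj (finiteGdim A)

/-- The triangulated structure of `D_def(A)`. -/
abbrev defectTriangles : TriangleStructure (DefectCategory A) :=
  verdierTriangles (finiteGdim A)

end

/-! ### Frobenius pairs -/

section

variable {A : Type u₁} [Category.{v₁} A] [Abelian A] {B : Type u₂} [Category.{v₂} B] [Abelian B]

/-- A Frobenius pair of type `(α, β)`: both `(F, G)` and `(G, β F α)` are adjoint pairs. -/
structure FrobeniusPair (F : A ⥤ B) (G : B ⥤ A) (α : A ≌ A) (β : B ≌ B) where
  additive_left : F.Additive
  additive_right : G.Additive
  adj : F ⊣ G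
  adj' : G ⊣ α.functor ⋙ F ⋙ β.functor

lemma map_gorensteinProjective {F : A ⥤ B} {G : B ⥤ A} (adj : F ⊣ G) [F.Additive]
    [PreservesFiniteLimits F] [PreservesFiniteColimits F]
    (hF : ∀ X, Projective X → Projective (F.obj X))
    (hG : ∀ Y, Projective Y → Projective (G.obj Y))
    (M : A) (hM : gorensteinProjective A M) : gorensteinProjective B (F.obj M) := by
  obtain ⟨P, hP, ⟨e⟩⟩ := hM
  refine ⟨(F.mapHomologicalComplex _).obj P, ⟨fun n => hF _ (hP.projective n), ?_, ?_⟩,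
    ⟨F.mapIso e ≪≫ ((P.sc 0).mapCyclesIso F).symm⟩⟩
  · intro n
    have h := hP.acyclic n
    rw [HomologicalComplex.exactAt_iff] at h ⊢
    exact h.map F
  · intro i j k hij hjk Q hQ
    have key : ∀ f : F.obj (P.X j) ⟶ Q, F.map (P.d i j) ≫ f = 0 →
        ∃ g : F.obj (P.X k) ⟶ Q, F.map (P.d j k) ≫ g = f := by
      intro f hf
      have := adj.right_adjoint_additive
      obtain ⟨g, hg⟩ := hP.hom_exact i j k hij hjk (G.obj Q) (hG Q hQ) (adj.homEquiv _ _ f) (by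
        rw [← adj.homEquiv_naturality_left, hf, adj.homEquiv_unit, Functor.map_zero, comp_zero])
      exact ⟨(adj.homEquiv _ _).symm g, by
        rw [← adj.homEquiv_naturality_left_symm, hg, Equiv.symm_apply_apply]⟩
    exact key

namespace FrobeniusPair

variable {F : A ⥤ B} {G : B ⥤ A} {α : A ≌ A} {β : B ≌ B}

lemma preservesFiniteColimits_left (h : FrobeniusPair F G α β) : PreservesFiniteColimits F :=
  have := h.adj.leftAdjoint_preservesColimits
  inferInstance

lemma preservesFiniteLimits_right (h : FrobeniusPair F G α β) : PreservesFiniteLimits G :=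
  have := h.adj.rightAdjoint_preservesLimits
  inferInstance

lemma preservesFiniteColimits_right (h : FrobeniusPair F G α β) : PreservesFiniteColimits G :=
  have := h.adj'.leftAdjoint_preservesColimits
  inferInstance

lemma preservesFiniteLimits_left (h : FrobeniusPair F G α β) : PreservesFiniteLimits F := by
  have := h.adj'.rightAdjoint_preservesLimits
  have : PreservesFiniteLimits (α.functor ⋙ F ⋙ β.functor) := inferInstance
  exact preservesFiniteLimits_of_natIso
    (F := α.inverse ⋙ (α.functor ⋙ F ⋙ β.functor) ⋙ β.inverse)
    (NatIso.ofComponents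
      (fun X => β.unitIso.symm.app _ ≪≫ F.mapIso (α.counitIso.app X))
      (fun f => by
        have h₁ := β.unitIso.inv.naturality (F.map (α.functor.map (α.inverse.map f)))
        have h₂ := α.counitIso.hom.naturality f
        dsimp at h₁ h₂ ⊢
        rw [reassoc_of% h₁, assoc, ← F.map_comp, h₂, F.map_comp]))

lemma projective_left (h : FrobeniusPair F G α β) (X : A) (hX : Projective X) :
    Projective (F.obj X) :=
  have := h.preservesFiniteColimits_right
  h.adj.map_projective X hX

lemma projective_right (h : FrobeniusPair F G α β) (Y : B) (hY : Projective Y) :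
    Projective (G.obj Y) :=
  have := h.preservesFiniteColimits_left
  h.adj'.map_projective Y hY

/-- The functor between the categories of Gorenstein projective objects given by `F`. -/
def gpLeft (h : FrobeniusPair F G α β) : GP A ⥤ GP B :=
  (gorensteinProjective B).lift ((gorensteinProjective A).ι ⋙ F) fun X =>
    have := h.additive_left
    have := h.preservesFiniteLimits_left
    have := h.preservesFiniteColimits_left
    map_gorensteinProjective h.adj h.projective_left h.projective_right X.obj X.property

/-- The functor between the categories of Gorenstein projective objects given by `G`. -/
def gpRight (h : FrobeniusPair F G α β) : GP B ⥤ GP A :=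
  (gorensteinProjective A).lift ((gorensteinProjective B).ι ⋙ G) fun Y =>
    have := h.additive_right
    have := h.preservesFiniteLimits_right
    have := h.preservesFiniteColimits_right
    map_gorensteinProjective h.adj' h.projective_right
      (fun X hX => β.map_projective_iff _ |>.2 (h.projective_left _ (α.map_projective_iff X |>.2 hX)))
      Y.obj Y.property

end FrobeniusPair

variable [HasDerivedCategory.{w₁} A] [HasDerivedCategory.{w₂} B]

/-- The functor `D^b(A) ⥤ D^b(B)` induced by an exact functor. -/
def mapBounded (F : A ⥤ B) [F.Additive] [PreservesFiniteLimits F] [PreservesFiniteColimits F] :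
    DerivedCategory.Bounded A ⥤ DerivedCategory.Bounded B :=
  DerivedCategory.TStructure.t.bounded.lift (DerivedCategory.Bounded.ι ⋙ F.mapDerivedCategory) (by
    rintro ⟨X, ⟨a, K, e, hK⟩, ⟨b, L, e', hL⟩⟩
    exact ⟨⟨a, (F.mapHomologicalComplex _).obj K,
        F.mapDerivedCategory.mapIso e ≪≫ F.mapDerivedCategoryFactors.app K, inferInstance⟩,
      ⟨b, (F.mapHomologicalComplex _).obj L,
        F.mapDerivedCategory.mapIso e' ≪≫ F.mapDerivedCategoryFactors.app L, inferInstance⟩⟩)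

namespace FrobeniusPair

variable {F : A ⥤ B} {G : B ⥤ A} {α : A ≌ A} {β : B ≌ B}

/-- The functor between bounded derived categories induced by the exact functor `F`. -/
def boundedLeft (h : FrobeniusPair F G α β) :
    DerivedCategory.Bounded A ⥤ DerivedCategory.Bounded B :=
  have := h.additive_left
  have := h.preservesFiniteLimits_left
  have := h.preservesFiniteColimits_left
  mapBounded F

/-- The functor between bounded derived categories induced by the exact functor `G`. -/
def boundedRight (h : FrobeniusPair F G α β) :
    DerivedCategory.Bounded B ⥤ DerivedCategory.Bounded A :=
  have := h.additive_right
  have := h.preservesFiniteLimits_right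
  have := h.preservesFiniteColimits_right
  mapBounded G

end FrobeniusPair

end

end FrobeniusGorenstein

end

noncomputable section

namespace FrobeniusGorenstein

/-! ### Comparison of conflations in the stable category -/

section

variable {A : Type u₁} [Category.{v₁} A] [Abelian A]

/-! Faithfulness of `F` and `G` makes every unit `η_X` a monomorphism and every counit `ε_Y` an
epimorphism. The hypotheses thus give short exact sequences `0 ⟶ X ⟶ GFX ⟶ P ⟶ 0` and `0 ⟶ P' ⟶ FGY
⟶ Y ⟶ 0` with `P`, `P'` projective, and it suffices that `η` and `ε` become invertible in each of
the three quotients.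

In the stable category the first sequence splits because `P` is projective. The second splits when
`Y` is Gorenstein projective, since then every extension of `Y` by a projective object is trivial
(`gorensteinProjective.exists_section`). So `η` and `ε` are isomorphisms up to projective summands.

On a bounded complex, `η` and `ε` applied degreewise are a monomorphism and an epimorphism whose
cokernel and kernel are bounded complexes of projectives (`complexesIn_trW_Q_map_of_mono`,
`complexesIn_trW_Q_map_of_epi`). Their cones therefore lie in `K^b(P)`, and also in the larger
subcategory of bounded complexes of Gorenstein projectives, so both Verdier quotients invert them.

The functors descend because `F`, `G` and the right adjoint `βFα` of `G` preserve projectives, hence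
`F` and `G` preserve Gorenstein projectives. On Verdier quotients the triangle structure is
inherited from the exact functors. On stable categories the image under `F` of the chosen conflation
of `X` must be compared with the chosen conflation of `FX`; the comparison is unique modulo
projectives, which yields its invertibility and naturality. -/

/-- `s` is induced by `f : X ⟶ Y` via a morphism of conflations `H ⟶ H'`. -/
def Hull.IsInduced {X Y : GP A} (H : Hull X) (H' : Hull Y) (f : X ⟶ Y) (s : H.S ⟶ H'.S) : Prop :=
  ∃ t : H.I ⟶ H'.I, H.i ≫ t = f.hom ≫ H'.i ∧ H.p ≫ s.hom = t ≫ H'.p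

lemma Hull.exists_isInduced {X Y : GP A} (H : Hull X) (H' : Hull Y) (f : X ⟶ Y) :
    ∃ s, H.IsInduced H' f s := by
  obtain ⟨t, ht⟩ := H.extend _ H'.projective (f.hom ≫ H'.i)
  have h : H.i ≫ t ≫ H'.p = 0 := by
    rw [← assoc, ht, assoc, H'.zero, comp_zero]
  have := H.shortExact.epi_g
  exact ⟨ObjectProperty.homMk (H.shortExact.exact.desc (t ≫ H'.p) h), t, ht,
    H.shortExact.exact.g_desc _ h⟩

/-- Two maps `t`, `t'` between the middle terms agree on `X`, so `t - t'` descends to `H.S ⟶ H'.I`;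
hence `s - s'` factors through the projective object `H'.I`. -/
lemma Hull.IsInduced.map_eq {X Y : GP A} {H : Hull X} {H' : Hull Y} {f : X ⟶ Y}
    {s s' : H.S ⟶ H'.S} (hs : H.IsInduced H' f s) (hs' : H.IsInduced H' f s') :
    (stableProj A).map s = (stableProj A).map s' := by
  obtain ⟨t, ht, hs⟩ := hs
  obtain ⟨t', ht', hs'⟩ := hs'
  have := H.shortExact.epi_g
  have hk : H.i ≫ (t - t') = 0 := by rw [Preadditive.comp_sub, ht, ht', sub_self]
  refine CategoryTheory.Quotient.sound _
    ⟨H'.I, H'.projective, H.shortExact.exact.desc _ hk, H'.p, ?_⟩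
  rw [← cancel_epi H.p, ← assoc]
  erw [H.shortExact.exact.g_desc _ hk]
  rw [Preadditive.comp_sub, hs, hs', Preadditive.sub_comp]

lemma Hull.IsInduced.comp {X Y Z : GP A} {H : Hull X} {H' : Hull Y} {H'' : Hull Z}
    {f : X ⟶ Y} {g : Y ⟶ Z} {s : H.S ⟶ H'.S} {s' : H'.S ⟶ H''.S}
    (hs : H.IsInduced H' f s) (hs' : H'.IsInduced H'' g s') :
    H.IsInduced H'' (f ≫ g) (s ≫ s') := by
  obtain ⟨t, ht, hs⟩ := hs
  obtain ⟨t', ht', hs'⟩ := hs'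
  refine ⟨t ≫ t', ?_, ?_⟩
  · rw [← assoc, ht, assoc, ht', ObjectProperty.FullSubcategory.comp_hom, assoc]
  · rw [ObjectProperty.FullSubcategory.comp_hom, ← assoc, hs, assoc, hs', assoc]

lemma Hull.isInduced_id {X : GP A} (H : Hull X) : H.IsInduced H (𝟙 X) (𝟙 H.S) :=
  ⟨𝟙 _, by simp, by simp⟩

/-- A comparison morphism between the cokernels of two conflations starting at `X`. -/
def Hull.compare {X : GP A} (H H' : Hull X) : H.S ⟶ H'.S :=
  (H.exists_isInduced H' (𝟙 X)).choose

lemma Hull.compare_spec {X : GP A} (H H' : Hull X) : H.IsInduced H' (𝟙 X) (H.compare H') :=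
  (H.exists_isInduced H' (𝟙 X)).choose_spec

lemma Hull.compare_comp_compare {X : GP A} (H H' : Hull X) :
    (stableProj A).map (H.compare H') ≫ (stableProj A).map (H'.compare H) = 𝟙 _ := by
  rw [← Functor.map_comp, ← CategoryTheory.Functor.map_id]
  refine Hull.IsInduced.map_eq (f := 𝟙 X) ?_ H.isInduced_id
  simpa using (H.compare_spec H').comp (H'.compare_spec H)

/-- The cokernels of two conflations starting at `X` are isomorphic in the stable category. -/
def Hull.compareIso {X : GP A} (H H' : Hull X) :
    (stableProj A).obj H.S ≅ (stableProj A).obj H'.S where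
  hom := (stableProj A).map (H.compare H')
  inv := (stableProj A).map (H'.compare H)
  hom_inv_id := H.compare_comp_compare H'
  inv_hom_id := H'.compare_comp_compare H

/-! ### Splittings -/

/-- A section of the cokernel projection yields a retraction `r` of `f`. It is a strict inverse on
one side, and on the other the defect from the identity factors through the cokernel. -/
lemma isIso_stableProj_map_of_projective_cokernel {X Y : GP A} (f : X ⟶ Y) [Mono f.hom]
    (h : Projective (cokernel f.hom)) : IsIso ((stableProj A).map f) := by
  let s := Projective.factorThru (𝟙 _) (cokernel.π f.hom)
  have hs : s ≫ cokernel.π f.hom = 𝟙 _ := Projective.factorThru_comp _ _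
  have hk : (𝟙 _ - cokernel.π f.hom ≫ s) ≫ cokernel.π f.hom = 0 := by
    simp [hs]
  let r : Y.obj ⟶ X.obj := Abelian.monoLift f.hom _ hk
  have hr : r ≫ f.hom = 𝟙 _ - cokernel.π f.hom ≫ s := Abelian.monoLift_comp _ _ _
  refine ⟨(stableProj A).map (ObjectProperty.homMk r), ?_, ?_⟩
  · rw [← Functor.map_comp, ← CategoryTheory.Functor.map_id]
    congr 1
    ext
    rw [← cancel_mono f.hom]
    simp [hr]
  · rw [← Functor.map_comp, ← CategoryTheory.Functor.map_id]
    exact CategoryTheory.Quotient.sound _ ⟨_, h, cokernel.π f.hom, -s, by simp [hr]⟩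

/-- This is the vanishing of `Ext¹(Z, K)` for `K = ker p` projective, computed from the totally
acyclic complex. A lift `l` of `P⁻¹ ⟶ Z` along `p` carries the image of `P⁻²` into `K`; the
resulting cocycle `P⁻² ⟶ K` extends over `P⁻¹` by `Hom(-, K)`-exactness, and subtracting the
extension makes `l` descend to `Z`. -/
lemma gorensteinProjective.exists_section {E Z : A} (hZ : gorensteinProjective A Z) (p : E ⟶ Z)
    [Epi p] (hK : Projective (kernel p)) : ∃ s : Z ⟶ E, s ≫ p = 𝟙 Z := by
  obtain ⟨P, hP, ⟨e⟩⟩ := hZ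
  have := hP.projective (-1)
  have : Epi (P.toCycles (-1) 0) :=
    Preadditive.epi_of_isZero_cokernel' _ (P.homologyIsCokernel (-1) 0 (by simp))
      (hP.acyclic 0).isZero_homology
  let π : P.X (-1) ⟶ Z := P.toCycles (-1) 0 ≫ e.inv
  have : Epi π := epi_comp _ _
  have hπ : P.d (-2) (-1) ≫ π = 0 := by simp [π]
  have hd : π ≫ e.hom ≫ P.iCycles 0 = P.d (-1) 0 := by simp [π]
  have hi : Mono (e.hom ≫ P.iCycles 0) := mono_comp _ _
  -- Followed by the monomorphism `Z ⟶ P⁰`, the map `π` is the differential, so exactness is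
  -- inherited from `P` in degree `-1`.
  have hex : (ShortComplex.mk (P.d (-2) (-1)) π hπ).Exact := by
    let φ : ShortComplex.mk (P.d (-2) (-1)) π hπ ⟶ P.sc' (-2) (-1) 0 :=
      { τ₁ := 𝟙 _
        τ₂ := 𝟙 _
        τ₃ := e.hom ≫ P.iCycles 0
        comm₁₂ := (id_comp _).trans (comp_id _).symm
        comm₂₃ := (id_comp _).trans hd.symm }
    have : Epi φ.τ₁ := inferInstanceAs (Epi (𝟙 _))
    have : IsIso φ.τ₂ := inferInstanceAs (IsIso (𝟙 _))
    have : Mono φ.τ₃ := hi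
    rw [ShortComplex.exact_iff_of_epi_of_isIso_of_mono φ]
    exact (P.exactAt_iff' (-2) (-1) 0 (by simp) (by simp)).1 (hP.acyclic (-1))
  let l := Projective.factorThru π p
  have hl : l ≫ p = π := Projective.factorThru_comp _ _
  let k : P.X (-2) ⟶ kernel p := kernel.lift p (P.d (-2) (-1) ≫ l) (by rw [assoc, hl, hπ])
  obtain ⟨g, hg⟩ := hP.hom_exact (-3) (-2) (-1) rfl rfl _ hK k (by
    rw [← cancel_mono (kernel.ι p)]
    simp [k])
  have hs : P.d (-2) (-1) ≫ (l - g ≫ kernel.ι p) = 0 := by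
    rw [Preadditive.comp_sub, reassoc_of% hg, kernel.lift_ι, sub_self]
  refine ⟨hex.desc _ hs, ?_⟩
  rw [← cancel_epi π, ← assoc]
  erw [hex.g_desc]
  simp [hl]

/-- Here the splitting comes from the target being Gorenstein projective; the section is a stable
inverse, with defect factoring through the kernel. -/
lemma isIso_stableProj_map_of_projective_kernel {X Y : GP A} (f : X ⟶ Y) [Epi f.hom]
    (h : Projective (kernel f.hom)) : IsIso ((stableProj A).map f) := by
  obtain ⟨s, hs⟩ := gorensteinProjective.exists_section Y.property f.hom h
  have hk : (f.hom ≫ s - 𝟙 _) ≫ f.hom = 0 := by simp [hs]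
  refine ⟨(stableProj A).map (ObjectProperty.homMk s), ?_, ?_⟩
  · rw [← Functor.map_comp, ← CategoryTheory.Functor.map_id]
    exact CategoryTheory.Quotient.sound _
      ⟨_, h, kernel.lift _ _ hk, kernel.ι f.hom, by simp⟩
  · rw [← Functor.map_comp, ← CategoryTheory.Functor.map_id]
    congr 1
    ext
    simpa using hs

end

/-! ### The functor induced on stable categories -/

section

variable {A : Type u₁} [Category.{v₁} A] [Abelian A] {B : Type u₂} [Category.{v₂} B] [Abelian B]
  {F : A ⥤ B} {R : B ⥤ A} (adj : F ⊣ R) [F.Additive]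
  [PreservesFiniteLimits F] [PreservesFiniteColimits F]
  (hF : ∀ X, Projective X → Projective (F.obj X))
  (hR : ∀ Y, Projective Y → Projective (R.obj Y))

/-- The functor between Gorenstein projective objects given by an exact functor which preserves
projective objects and has a right adjoint preserving projective objects. -/
abbrev gpMap : GP A ⥤ GP B :=
  (gorensteinProjective B).lift ((gorensteinProjective A).ι ⋙ F) fun X =>
    map_gorensteinProjective adj hF hR X.obj X.property

/-- The image of a conflation. -/
abbrev Hull.map {X : GP A} (H : Hull X) : Hull ((gpMap adj hF hR).obj X) where
  I := F.obj H.I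
  S := (gpMap adj hF hR).obj H.S
  i := F.map H.i
  p := F.map H.p
  zero := by rw [← F.map_comp, H.zero, F.map_zero]
  projective := hF _ H.projective
  shortExact := H.shortExact.map_of_exact F
  extend Q hQ f := by
    -- Maps from `FX` to `Q` correspond to maps from `X` to `RQ`, and `RQ` is again projective.
    obtain ⟨g, hg⟩ := H.extend _ (hR Q hQ) (adj.homEquiv _ _ f)
    exact ⟨(adj.homEquiv _ _).symm g, (adj.homEquiv_naturality_left_symm _ _).symm.trans
      (((adj.homEquiv _ _).symm_apply_eq).2 hg)⟩

lemma Hull.IsInduced.map {X Y : GP A} {H : Hull X} {H' : Hull Y} {f : X ⟶ Y} {s : H.S ⟶ H'.S}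
    (hs : H.IsInduced H' f s) :
    (H.map adj hF hR).IsInduced (H'.map adj hF hR) ((gpMap adj hF hR).map f)
      ((gpMap adj hF hR).map s) := by
  obtain ⟨t, ht, hs⟩ := hs
  exact ⟨F.map t, (F.map_comp _ _).symm.trans ((congrArg F.map ht).trans (F.map_comp _ _)),
    (F.map_comp _ _).symm.trans ((congrArg F.map hs).trans (F.map_comp _ _))⟩

/-- The functor induced on stable categories. -/
def stableMap : StableGP A ⥤ StableGP B :=
  CategoryTheory.Quotient.lift (stableRel A) (gpMap adj hF hR ⋙ stableProj B) (by
    rintro X Y f g ⟨Q, hQ, a, b, h⟩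
    refine CategoryTheory.Quotient.sound _ ⟨F.obj Q, hF Q hQ, F.map a, F.map b, ?_⟩
    rw [← F.map_comp, ← h, F.map_sub]
    rfl)

/-- The functor induced on stable categories commutes with the projections. -/
def stableProjCompStableMap :
    stableProj A ⋙ stableMap adj hF hR ≅ gpMap adj hF hR ⋙ stableProj B :=
  CategoryTheory.Quotient.lift.isLift _ _ _

/-- Both composites are induced by `F(f)` between the image of the conflation of `X` and the chosen
conflation of `FY`, so they agree stably by `Hull.IsInduced.map_eq`. -/
lemma map_suspMap_comp_compare {X Y : GP A} (f : X ⟶ Y) :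
    (stableProj B).map ((gpMap adj hF hR).map (suspMap f)) ≫ (stableProj B).map
        (((hull Y).map adj hF hR).compare (hull ((gpMap adj hF hR).obj Y))) =
      (stableProj B).map (((hull X).map adj hF hR).compare (hull ((gpMap adj hF hR).obj X))) ≫
        (stableProj B).map (suspMap ((gpMap adj hF hR).map f)) := by
  have h₁ := (Hull.IsInduced.map adj hF hR (suspMap_spec f)).comp
    (((hull Y).map adj hF hR).compare_spec (hull _))
  have h₂ := (((hull X).map adj hF hR).compare_spec (hull _)).comp
    (suspMap_spec ((gpMap adj hF hR).map f))
  rw [comp_id] at h₁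
  rw [id_comp] at h₂
  exact ((stableProj B).map_comp _ _).symm.trans
    ((h₁.map_eq h₂).trans ((stableProj B).map_comp _ _))

/-- The functor induced on stable categories commutes with the suspensions. -/
def stableMapSuspIso :
    stableSusp A ⋙ stableMap adj hF hR ≅ stableMap adj hF hR ⋙ stableSusp B :=
  CategoryTheory.Quotient.natIsoLift _ (NatIso.ofComponents
    (fun X => ((hull X).map adj hF hR).compareIso (hull ((gpMap adj hF hR).obj X)))
    (fun f => map_suspMap_comp_compare adj hF hR f))

lemma IsStandardTriangle.map {X Y Z : GP A} {u : X ⟶ Y} {v : Y ⟶ Z} {w : Z ⟶ (hull X).S}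
    (h : IsStandardTriangle u v w) :
    IsStandardTriangle ((gpMap adj hF hR).map u) ((gpMap adj hF hR).map v)
      ((gpMap adj hF hR).map w ≫ ((hull X).map adj hF hR).compare (hull _)) := by
  obtain ⟨zero, shortExact, t, ht, hw⟩ := h
  obtain ⟨t', ht', hs⟩ := ((hull X).map adj hF hR).compare_spec (hull ((gpMap adj hF hR).obj X))
  have ht'' : F.map (hull X).i ≫ t' = (hull ((gpMap adj hF hR).obj X)).i :=
    ht'.trans (id_comp _)
  -- `F(t)` ends in `F(I(X))`; the map `t'` underlying the comparison carries it on to `I(FX)`.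
  refine ⟨?_, shortExact.map_of_exact F, F.map t ≫ t', ?_, ?_⟩
  · change F.map u.hom ≫ F.map v.hom = 0
    rw [← F.map_comp, zero, F.map_zero]
  · change F.map u.hom ≫ F.map t ≫ t' = _
    rw [← F.map_comp_assoc, ht, ht'']
  · change F.map v.hom ≫ F.map w.hom ≫
      (((hull X).map adj hF hR).compare (hull ((gpMap adj hF hR).obj X))).hom = _
    rw [← F.map_comp_assoc, hw, F.map_neg, Preadditive.neg_comp, F.map_comp, assoc, assoc]
    exact congrArg (fun k => -(F.map t ≫ k)) hs

lemma isTriangleFunctor_stableMap :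
    IsTriangleFunctor (stableTriangles A) (stableTriangles B) (stableMap adj hF hR) := by
  refine ⟨stableMapSuspIso adj hF hR, ?_⟩
  rintro X Y Z f g h ⟨X', Y', Z', u, v, w, hT, a, b, c, h₁, h₂, h₃⟩
  let Φ := stableMap adj hF hR
  refine ⟨_, _, _, _, _, _, hT.map adj hF hR, Φ.mapIso a, Φ.mapIso b, Φ.mapIso c, ?_, ?_, ?_⟩
  · exact (Φ.map_comp _ _).symm.trans ((congrArg Φ.map h₁).trans (Φ.map_comp _ _))
  · exact (Φ.map_comp _ _).symm.trans ((congrArg Φ.map h₂).trans (Φ.map_comp _ _))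
  · have nat := (stableMapSuspIso adj hF hR).hom.naturality a.hom
    have h₃' : Φ.map h ≫ Φ.map ((stableSusp A).map a.hom) =
        Φ.map c.hom ≫ Φ.map ((stableProj A).map w) :=
      (Φ.map_comp _ _).symm.trans ((congrArg Φ.map h₃).trans (Φ.map_comp _ _))
    -- Naturality of the suspension isomorphism at `a.hom` reduces the last square to the image of
    -- `h₃`.
    calc
      _ = Φ.map h ≫ (stableSusp A ⋙ Φ).map a.hom ≫ (stableMapSuspIso adj hF hR).hom.app _ :=
        (assoc _ _ _).trans (congrArg (Φ.map h ≫ ·) nat.symm)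
      _ = (Φ.map c.hom ≫ Φ.map ((stableProj A).map w)) ≫
          (stableMapSuspIso adj hF hR).hom.app _ :=
        (assoc _ _ _).symm.trans (congrArg (· ≫ (stableMapSuspIso adj hF hR).hom.app _) h₃')
      _ = _ := (assoc _ _ _).trans
        (congrArg (Φ.map c.hom ≫ ·) ((stableProj B).map_comp _ _).symm)

end

/-! ### The stable equivalence -/

section

variable {A : Type u₁} [Category.{v₁} A] [Abelian A] {B : Type u₂} [Category.{v₂} B] [Abelian B]

/-- Two exact functors related by natural transformations which are stably invertible induce
a triangle equivalence between the stable categories. -/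
lemma induceTriangleEquivalence_stable
    {F : A ⥤ B} {R : B ⥤ A} (adj : F ⊣ R) [F.Additive]
    [PreservesFiniteLimits F] [PreservesFiniteColimits F]
    (hF : ∀ X, Projective X → Projective (F.obj X))
    (hR : ∀ Y, Projective Y → Projective (R.obj Y))
    {G : B ⥤ A} {R' : A ⥤ B} (adj' : G ⊣ R') [G.Additive]
    [PreservesFiniteLimits G] [PreservesFiniteColimits G]
    (hG : ∀ Y, Projective Y → Projective (G.obj Y))
    (hR' : ∀ X, Projective X → Projective (R'.obj X))
    (η : 𝟭 A ⟶ F ⋙ G) (ε : G ⋙ F ⟶ 𝟭 B)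
    (hη : ∀ X, Mono (η.app X)) (hε : ∀ Y, Epi (ε.app Y))
    (hη' : ∀ X, Projective (cokernel (η.app X))) (hε' : ∀ Y, Projective (kernel (ε.app Y))) :
    InduceTriangleEquivalence (stableProj A) (stableProj B)
      (stableTriangles A) (stableTriangles B) (gpMap adj hF hR) (gpMap adj' hG hR') := by
  let ηGP (X : GP A) : X ⟶ (gpMap adj' hG hR').obj ((gpMap adj hF hR).obj X) :=
    ObjectProperty.homMk (η.app X.obj)
  let εGP (Y : GP B) : (gpMap adj hF hR).obj ((gpMap adj' hG hR').obj Y) ⟶ Y :=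
    ObjectProperty.homMk (ε.app Y.obj)
  have isoη (X : GP A) : IsIso ((stableProj A).map (ηGP X)) :=
    have : Mono (ηGP X).hom := hη X.obj
    isIso_stableProj_map_of_projective_cokernel _ (hη' X.obj)
  have isoε (Y : GP B) : IsIso ((stableProj B).map (εGP Y)) :=
    have : Epi (εGP Y).hom := hε Y.obj
    isIso_stableProj_map_of_projective_kernel _ (hε' Y.obj)
  refine ⟨CategoryTheory.Equivalence.mk (stableMap adj hF hR) (stableMap adj' hG hR')
    (CategoryTheory.Quotient.natIsoLift _ (NatIso.ofComponents
      (fun X => @asIso _ _ _ _ _ (isoη X)) (fun {X Y} f => ?_)))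
    (CategoryTheory.Quotient.natIsoLift _ (NatIso.ofComponents
      (fun Y => @asIso _ _ _ _ _ (isoε Y)) (fun {X Y} f => ?_))),
    ⟨stableProjCompStableMap adj hF hR⟩, ⟨stableProjCompStableMap adj' hG hR'⟩,
    isTriangleFunctor_stableMap adj hF hR, isTriangleFunctor_stableMap adj' hG hR'⟩
  · change (stableProj A).map f ≫ (stableProj A).map _ = (stableProj A).map _ ≫
      (stableProj A).map ((gpMap adj' hG hR').map ((gpMap adj hF hR).map f))
    rw [← Functor.map_comp, ← Functor.map_comp]
    congr 1
    ext
    exact η.naturality f.hom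
  · change (stableProj B).map ((gpMap adj hF hR).map ((gpMap adj' hG hR').map f)) ≫
      (stableProj B).map _ = (stableProj B).map _ ≫ (stableProj B).map f
    rw [← Functor.map_comp, ← Functor.map_comp]
    congr 1
    ext
    exact ε.naturality f.hom

end

open DerivedCategory

/-! ### Projective objects are Gorenstein projective -/

section

variable {A : Type u₁} [Category.{v₁} A] [Abelian A]

/-- The only nonzero differential is invertible, so exactness, also after `Hom(-, Q)`, is immediate.
Using degrees `-1` and `0` makes the zeroth cocycles all of `P`; degrees `0` and `1` would give
zero. -/
lemma isTotallyAcyclic_double (P : A) [Projective P] (hrel : (ComplexShape.up ℤ).Rel (-1) 0) :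
    IsTotallyAcyclic (HomologicalComplex.double (𝟙 P) hrel) := by
  have hne : (-1 : ℤ) ≠ 0 := by lia
  have hiso : IsIso ((HomologicalComplex.double (𝟙 P) hrel).d (-1) 0) := by
    rw [HomologicalComplex.double_d _ _ hne]
    infer_instance
  have hzero (n : ℤ) (h₀ : n ≠ -1) (h₁ : n ≠ 0) :=
    HomologicalComplex.isZero_double_X (𝟙 P) hrel n h₀ h₁
  refine ⟨fun n => ?_, fun n => ?_, fun i j k hij hjk Q hQ f hf => ?_⟩
  · by_cases h₀ : n = -1
    · subst h₀
      exact Projective.of_iso (HomologicalComplex.doubleXIso₀ (𝟙 P) hrel).symm inferInstance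
    by_cases h₁ : n = 0
    · subst h₁
      exact Projective.of_iso (HomologicalComplex.doubleXIso₁ (𝟙 P) hrel hne).symm inferInstance
    exact Projective.of_iso (hzero n h₀ h₁).isoZero.symm inferInstance
  · by_cases h₀ : n = -1
    · subst h₀
      rw [HomologicalComplex.exactAt_iff' _ (-2) (-1) 0 (by simp) (by simp),
        ShortComplex.exact_iff_mono _ (HomologicalComplex.double_d_eq_zero₀ _ hrel _ _ (by lia))]
      exact inferInstanceAs (Mono ((HomologicalComplex.double (𝟙 P) hrel).d (-1) 0))
    by_cases h₁ : n = 0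
    · subst h₁
      rw [HomologicalComplex.exactAt_iff' _ (-1) 0 1 (by simp) (by simp),
        ShortComplex.exact_iff_epi _ (HomologicalComplex.double_d_eq_zero₀ _ hrel _ _ (by lia))]
      exact inferInstanceAs (Epi ((HomologicalComplex.double (𝟙 P) hrel).d (-1) 0))
    rw [HomologicalComplex.exactAt_iff]
    exact ShortComplex.exact_of_isZero_X₂ _ (hzero n h₀ h₁)
  · by_cases h₀ : j = -1
    · obtain rfl : k = 0 := by lia
      subst h₀
      exact ⟨inv ((HomologicalComplex.double (𝟙 P) hrel).d (-1) 0) ≫ f,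
        IsIso.hom_inv_id_assoc _ _⟩
    refine ⟨0, ?_⟩
    rw [comp_zero]
    by_cases h₁ : j = 0
    · obtain rfl : i = -1 := by lia
      subst h₁
      exact ((cancel_epi ((HomologicalComplex.double (𝟙 P) hrel).d (-1) 0)).1
        (hf.trans comp_zero.symm)).symm
    exact (hzero j h₀ h₁).eq_of_src _ _

lemma gorensteinProjective_of_projective (P : A) (hP : Projective P) :
    gorensteinProjective A P :=
  ⟨_, isTotallyAcyclic_double P (by simp),
    ⟨(HomologicalComplex.doubleXIso₁ (𝟙 P) _ (by lia)).symm ≪≫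
      (HomologicalComplex.iCyclesIso _ 0 1 (by simp)
        (HomologicalComplex.double_d_eq_zero₀ _ _ _ _ (by lia))).symm⟩⟩

end

/-! ### Bounded complexes in the derived category -/

section

variable {A : Type u₁} [Category.{v₁} A] [Abelian A] [HasDerivedCategory.{w₁} A]

/-- The objects of the derived category isomorphic to a bounded complex with all components
in `S`. -/
def complexesIn (S : ObjectProperty A) : ObjectProperty (DerivedCategory A) :=
  fun X => ∃ (K : CochainComplex A ℤ) (a b : ℤ), K.IsStrictlyGE a ∧ K.IsStrictlyLE b ∧
    (∀ n, S (K.X n)) ∧ Nonempty (X ≅ Q.obj K)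

/-- Membership depends only on the underlying object of `D(A)`, so cones can be computed there,
where short exact sequences of complexes give triangles. -/
lemma boundedComplexesIn_eq (S : ObjectProperty A) :
    boundedComplexesIn A S = (complexesIn S).inverseImage Bounded.ι := rfl

instance (S : ObjectProperty A) : (complexesIn S).IsClosedUnderIsomorphisms where
  of_iso := by
    rintro X Y e ⟨K, a, b, ha, hb, hS, ⟨e'⟩⟩
    exact ⟨K, a, b, ha, hb, hS, ⟨e.symm ≪≫ e'⟩⟩

instance (S : ObjectProperty A) : (complexesIn S).IsStableUnderShift ℤ where
  isStableUnderShiftBy n :=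
    { le_shift := by
        rintro X ⟨K, a, b, ha, hb, hS, ⟨e⟩⟩
        exact ⟨K⟦n⟧, a - n, b - n, K.isStrictlyGE_shift a n (a - n) (by lia),
          K.isStrictlyLE_shift b n (b - n) (by lia), fun i => hS (i + n),
          ⟨(shiftFunctor (DerivedCategory A) n).mapIso e ≪≫ (Q.commShiftIso n).symm.app K⟩⟩ }

/-- The cone of `φ` is represented by its cokernel, which is computed degreewise and inherits its
bounds from `L`. -/
lemma complexesIn_trW_Q_map_of_mono {S : ObjectProperty A} (hS : ∀ X, Projective X → S X)
    {K L : CochainComplex A ℤ} (φ : K ⟶ L) (a b : ℤ) [L.IsStrictlyGE a] [L.IsStrictlyLE b]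
    [hφ : ∀ n, Mono (φ.f n)] (hφ' : ∀ n, Projective (cokernel (φ.f n))) :
    (complexesIn S).trW (Q.map φ) := by
  have : Mono φ := HomologicalComplex.mono_of_mono_f _ hφ
  have hS' : (ShortComplex.mk φ (cokernel.π φ) (cokernel.condition φ)).ShortExact :=
    { exact := ShortComplex.exact_cokernel φ }
  have hX (n : ℤ) : Epi ((cokernel.π φ).f n) := inferInstance
  refine ObjectProperty.trW.mk _ (triangleOfSES_distinguished hS')
    ⟨cokernel φ, a, b, ?_, ?_, fun n => hS _ ?_, ⟨Iso.refl _⟩⟩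
  · rw [CochainComplex.isStrictlyGE_iff]
    intro i hi
    exact IsZero.of_epi ((cokernel.π φ).f i) (L.isZero_of_isStrictlyGE a i hi)
  · rw [CochainComplex.isStrictlyLE_iff]
    intro i hi
    exact IsZero.of_epi ((cokernel.π φ).f i) (L.isZero_of_isStrictlyLE b i hi)
  · exact Projective.of_iso
      (PreservesCokernel.iso (HomologicalComplex.eval A (ComplexShape.up ℤ) n) φ).symm (hφ' n)

/-- The cone is a shift of the kernel, whose bounds come from `K`; stability under shift then allows
testing the first vertex of the triangle. -/
lemma complexesIn_trW_Q_map_of_epi {S : ObjectProperty A} (hS : ∀ X, Projective X → S X)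
    {K L : CochainComplex A ℤ} (φ : K ⟶ L) (a b : ℤ) [K.IsStrictlyGE a] [K.IsStrictlyLE b]
    [hφ : ∀ n, Epi (φ.f n)] (hφ' : ∀ n, Projective (kernel (φ.f n))) :
    (complexesIn S).trW (Q.map φ) := by
  have : Epi φ := HomologicalComplex.epi_of_epi_f _ hφ
  have hS' : (ShortComplex.mk (kernel.ι φ) φ (kernel.condition φ)).ShortExact :=
    { exact := ShortComplex.exact_kernel φ }
  have hX (n : ℤ) : Mono ((kernel.ι φ).f n) := inferInstance
  refine ObjectProperty.trW.mk' _ (triangleOfSES_distinguished hS')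
    ⟨kernel φ, a, b, ?_, ?_, fun n => hS _ ?_, ⟨Iso.refl _⟩⟩
  · rw [CochainComplex.isStrictlyGE_iff]
    intro i hi
    exact IsZero.of_mono ((kernel.ι φ).f i) (K.isZero_of_isStrictlyGE a i hi)
  · rw [CochainComplex.isStrictlyLE_iff]
    intro i hi
    exact IsZero.of_mono ((kernel.ι φ).f i) (K.isZero_of_isStrictlyLE b i hi)
  · exact Projective.of_iso
      (PreservesKernel.iso (HomologicalComplex.eval A (ComplexShape.up ℤ) n) φ).symm (hφ' n)

/-- A natural transformation between functors on complexes induces a natural transformation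
between functors on the derived category; its cones on bounded objects belong to `N` if this holds
for bounded complexes. -/
lemma exists_natTrans_trW (N : ObjectProperty (DerivedCategory A))
    {Φ₁ Φ₂ : DerivedCategory A ⥤ DerivedCategory A}
    {Ψ₁ Ψ₂ : CochainComplex A ℤ ⥤ CochainComplex A ℤ}
    (e₁ : Q ⋙ Φ₁ ≅ Ψ₁ ⋙ Q) (e₂ : Q ⋙ Φ₂ ≅ Ψ₂ ⋙ Q) (τ : Ψ₁ ⟶ Ψ₂)
    (h : ∀ (K : CochainComplex A ℤ) (a b : ℤ) [K.IsStrictlyGE a] [K.IsStrictlyLE b],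
      N.trW (Q.map (τ.app K))) :
    ∃ σ : Φ₁ ⟶ Φ₂, ∀ X : Bounded A, N.trW (σ.app X.obj) := by
  let W := HomologicalComplex.quasiIso A (ComplexShape.up ℤ)
  let : Localization.Lifting Q W (Ψ₁ ⋙ Q) Φ₁ := ⟨e₁⟩
  let : Localization.Lifting Q W (Ψ₂ ⋙ Q) Φ₂ := ⟨e₂⟩
  let σ : Φ₁ ⟶ Φ₂ :=
    Localization.liftNatTrans Q W (Ψ₁ ⋙ Q) (Ψ₂ ⋙ Q) Φ₁ Φ₂ (Functor.whiskerRight τ Q)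
  have hσ (K : CochainComplex A ℤ) :
      σ.app (Q.obj K) = e₁.hom.app K ≫ Q.map (τ.app K) ≫ e₂.inv.app K :=
    Localization.liftNatTrans_app _ _ _ _ _ _ _ _
  refine ⟨σ, ?_⟩
  rintro ⟨X, ⟨a, ha⟩, ⟨b, hb⟩⟩
  have : X.IsGE a := ha
  have : X.IsLE b := hb
  -- An object with cohomology in `[a, b]` is represented by a complex strictly concentrated in `[a,
  -- b]`, to which `h` applies.
  obtain ⟨K, _, _, ⟨e⟩⟩ := exists_iso_Q_obj_of_isGE_of_isLE X a b
  refine (N.trW.arrow_mk_iso_iff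
    (Arrow.isoMk (Φ₁.mapIso e ≪≫ e₁.app K) (Φ₂.mapIso e ≪≫ e₂.app K) ?_)).2 (h K a b)
  have := σ.naturality e.hom
  dsimp at this ⊢
  rw [← reassoc_of% this, hσ]
  simp

end

/-! ### Exact functors on bounded derived categories -/

section

variable {A : Type u₁} [Category.{v₁} A] [Abelian A] [HasDerivedCategory.{w₁} A]
  {B : Type u₂} [Category.{v₂} B] [Abelian B] [HasDerivedCategory.{w₂} B]
  (F : A ⥤ B) [F.Additive] [PreservesFiniteLimits F] [PreservesFiniteColimits F]
  (G : B ⥤ A) [G.Additive] [PreservesFiniteLimits G] [PreservesFiniteColimits G]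

instance : (mapBounded F).CommShift ℤ := by
  dsimp only [mapBounded]
  infer_instance

instance : (mapBounded F).IsTriangulated := by
  dsimp only [mapBounded]
  infer_instance

lemma boundedComplexesIn_mapBounded {S : ObjectProperty A} {T : ObjectProperty B}
    (hF : ∀ X, S X → T (F.obj X)) (X : Bounded A) (hX : boundedComplexesIn A S X) :
    boundedComplexesIn B T ((mapBounded F).obj X) := by
  obtain ⟨K, a, b, ha, hb, hS, ⟨e⟩⟩ := hX
  exact ⟨(F.mapHomologicalComplex _).obj K, a, b, inferInstance, inferInstance,
    fun n => hF _ (hS n), ⟨F.mapDerivedCategory.mapIso e ≪≫ F.mapDerivedCategoryFactors.app K⟩⟩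

/-- The composition of two exact functors on derived categories is induced by their composition
on complexes. -/
def mapDerivedCategoryCompFactors :
    Q ⋙ F.mapDerivedCategory ⋙ G.mapDerivedCategory ≅
      (F.mapHomologicalComplex (ComplexShape.up ℤ) ⋙
        G.mapHomologicalComplex (ComplexShape.up ℤ)) ⋙ Q :=
  (Functor.associator _ _ _).symm ≪≫
    Functor.isoWhiskerRight F.mapDerivedCategoryFactors _ ≪≫
    Functor.associator _ _ _ ≪≫
    Functor.isoWhiskerLeft _ G.mapDerivedCategoryFactors ≪≫
    (Functor.associator _ _ _).symm

variable {F G}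

instance (K : CochainComplex A ℤ) (n : ℤ) [K.IsStrictlyGE n] :
    CochainComplex.IsStrictlyGE ((F.mapHomologicalComplex (ComplexShape.up ℤ) ⋙
      G.mapHomologicalComplex (ComplexShape.up ℤ)).obj K) n :=
  inferInstanceAs (CochainComplex.IsStrictlyGE ((G.mapHomologicalComplex (ComplexShape.up ℤ)).obj
    ((F.mapHomologicalComplex (ComplexShape.up ℤ)).obj K)) n)

instance (K : CochainComplex A ℤ) (n : ℤ) [K.IsStrictlyLE n] :
    CochainComplex.IsStrictlyLE ((F.mapHomologicalComplex (ComplexShape.up ℤ) ⋙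
      G.mapHomologicalComplex (ComplexShape.up ℤ)).obj K) n :=
  inferInstanceAs (CochainComplex.IsStrictlyLE ((G.mapHomologicalComplex (ComplexShape.up ℤ)).obj
    ((F.mapHomologicalComplex (ComplexShape.up ℤ)).obj K)) n)

/-- The natural transformation on complexes induced by `η`. -/
def complexUnit (η : 𝟭 A ⟶ F ⋙ G) :
    𝟭 (CochainComplex A ℤ) ⟶ F.mapHomologicalComplex (ComplexShape.up ℤ) ⋙
      G.mapHomologicalComplex (ComplexShape.up ℤ) where
  app K :=
    { f := fun n => η.app (K.X n)
      comm' := fun i j _ => (η.naturality (K.d i j)).symm }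
  naturality K L φ := by
    ext n
    exact η.naturality (φ.f n)

/-- The natural transformation on complexes induced by `ε`. -/
def complexCounit (ε : F ⋙ G ⟶ 𝟭 A) :
    F.mapHomologicalComplex (ComplexShape.up ℤ) ⋙
      G.mapHomologicalComplex (ComplexShape.up ℤ) ⟶ 𝟭 (CochainComplex A ℤ) where
  app K :=
    { f := fun n => ε.app (K.X n)
      comm' := fun i j _ => (ε.naturality (K.d i j)).symm }
  naturality K L φ := by
    ext n
    exact ε.naturality (φ.f n)

lemma exists_boundedUnit (η : 𝟭 A ⟶ F ⋙ G) (hη : ∀ X, Mono (η.app X))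
    (hη' : ∀ X, Projective (cokernel (η.app X)))
    {S : ObjectProperty A} (hS : ∀ X, Projective X → S X) :
    ∃ σ : 𝟭 (Bounded A) ⟶ mapBounded F ⋙ mapBounded G,
      ∀ X, (boundedComplexesIn A S).trW (σ.app X) := by
  obtain ⟨σ, hσ⟩ := exists_natTrans_trW (complexesIn S)
    (Functor.rightUnitor Q ≪≫ (Functor.leftUnitor Q).symm)
    (mapDerivedCategoryCompFactors F G) (complexUnit η) (fun K a b _ _ => by
      have (n : ℤ) : Mono (((complexUnit η).app K).f n) := hη _
      exact complexesIn_trW_Q_map_of_mono hS ((complexUnit η).app K) a b (fun n => hη' _))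
  refine ⟨{ app := fun X => ObjectProperty.homMk (σ.app X.obj)
            naturality := fun X Y f => ?_ }, fun X => ?_⟩
  · ext
    exact σ.naturality f.hom
  · rw [boundedComplexesIn_eq, ObjectProperty.inverseImage_trW_iff]
    exact hσ X

lemma exists_boundedCounit (ε : F ⋙ G ⟶ 𝟭 A) (hε : ∀ X, Epi (ε.app X))
    (hε' : ∀ X, Projective (kernel (ε.app X)))
    {S : ObjectProperty A} (hS : ∀ X, Projective X → S X) :
    ∃ σ : mapBounded F ⋙ mapBounded G ⟶ 𝟭 (Bounded A),
      ∀ X, (boundedComplexesIn A S).trW (σ.app X) := by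
  obtain ⟨σ, hσ⟩ := exists_natTrans_trW (complexesIn S)
    (mapDerivedCategoryCompFactors F G)
    (Functor.rightUnitor Q ≪≫ (Functor.leftUnitor Q).symm)
    (complexCounit ε) (fun K a b _ _ => by
      have (n : ℤ) : Epi (((complexCounit ε).app K).f n) := hε _
      exact complexesIn_trW_Q_map_of_epi hS ((complexCounit ε).app K) a b (fun n => hε' _))
  refine ⟨{ app := fun X => ObjectProperty.homMk (σ.app X.obj)
            naturality := fun X Y f => ?_ }, fun X => ?_⟩
  · ext
    exact σ.naturality f.hom
  · rw [boundedComplexesIn_eq, ObjectProperty.inverseImage_trW_iff]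
    exact hσ X

end

/-! ### Functors between Verdier quotients -/

section

variable {A : Type u₁} [Category.{v₁} A] [Abelian A] [HasDerivedCategory.{w₁} A]
  {B : Type u₂} [Category.{v₂} B] [Abelian B] [HasDerivedCategory.{w₂} B]
  {N : ObjectProperty (Bounded A)} {N' : ObjectProperty (Bounded B)}

lemma trW_map {Φ : Bounded A ⥤ Bounded B} [Φ.CommShift ℤ] [Φ.IsTriangulated]
    (hΦ : ∀ X, N X → N' (Φ.obj X)) {X Y : Bounded A} (f : X ⟶ Y) (hf : N.trW f) :
    N'.trW (Φ.map f) := by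
  rw [ObjectProperty.trW_iff] at hf
  obtain ⟨Z, g, h, hT, hZ⟩ := hf
  exact ObjectProperty.trW.mk _ (Φ.map_distinguished _ hT) (hΦ Z hZ)

variable [N.IsStableUnderShift ℤ] [N'.IsStableUnderShift ℤ]

/-- A functor between Verdier quotients induced by a triangulated functor is a triangle
functor. -/
lemma isTriangleFunctor_of_lifting (Φ : Bounded A ⥤ Bounded B) [Φ.CommShift ℤ]
    [Φ.IsTriangulated] (Φ' : VerdierQuotient N ⥤ VerdierQuotient N')
    [Localization.Lifting (verdierProj N) N.trW (Φ ⋙ verdierProj N') Φ'] :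
    IsTriangleFunctor (verdierTriangles N) (verdierTriangles N') Φ' := by
  -- The compatibility of `Φ'` with shifts descends from that of `Φ` followed by the quotient
  -- functor.
  let := Functor.commShiftOfLocalization (verdierProj N) N.trW ℤ (Φ ⋙ verdierProj N') Φ'
  refine ⟨Φ'.commShiftIso (1 : ℤ), ?_⟩
  rintro X Y Z f g h ⟨T, e, hT⟩
  exact ⟨Φ.mapTriangle.obj T, Φ'.mapTriangle.mapIso e ≪≫
    (Functor.mapTriangleCompIso (verdierProj N) Φ').symm.app T ≪≫
    (Functor.mapTriangleIso
      (Localization.Lifting.iso (verdierProj N) N.trW (Φ ⋙ verdierProj N') Φ')).app T ≪≫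
    (Functor.mapTriangleCompIso Φ (verdierProj N')).app T, Φ.map_distinguished T hT⟩

/-- Triangulated functors which are mutually quasi-inverse up to morphisms with cones in the given
subcategories induce a triangle equivalence between the Verdier quotients. -/
lemma induceTriangleEquivalence_verdier
    (Φ : Bounded A ⥤ Bounded B) [Φ.CommShift ℤ] [Φ.IsTriangulated]
    (Γ : Bounded B ⥤ Bounded A) [Γ.CommShift ℤ] [Γ.IsTriangulated]
    (hΦ : ∀ X, N X → N' (Φ.obj X)) (hΓ : ∀ Y, N' Y → N (Γ.obj Y))
    (η : 𝟭 _ ⟶ Φ ⋙ Γ) (hη : ∀ X, N.trW (η.app X))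
    (ε : Γ ⋙ Φ ⟶ 𝟭 _) (hε : ∀ Y, N'.trW (ε.app Y)) :
    InduceTriangleEquivalence (verdierProj N) (verdierProj N')
      (verdierTriangles N) (verdierTriangles N') Φ Γ := by
  let L := verdierProj N
  let M := verdierProj N'
  have invΦ : N.trW.IsInvertedBy (Φ ⋙ M) := fun X Y f hf =>
    Localization.inverts M N'.trW _ (trW_map hΦ f hf)
  have invΓ : N'.trW.IsInvertedBy (Γ ⋙ L) := fun X Y f hf =>
    Localization.inverts L N.trW _ (trW_map hΓ f hf)
  let Φ' := Localization.lift (Φ ⋙ M) invΦ L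
  let Γ' := Localization.lift (Γ ⋙ L) invΓ M
  have isoη : ∀ X, IsIso ((Functor.whiskerRight η L).app X) := fun X =>
    Localization.inverts L N.trW _ (hη X)
  have isoε : ∀ Y, IsIso ((Functor.whiskerRight ε M).app Y) := fun Y =>
    Localization.inverts M N'.trW _ (hε Y)
  have : IsIso (Functor.whiskerRight η L) := NatIso.isIso_of_isIso_app _
  have : IsIso (Functor.whiskerRight ε M) := NatIso.isIso_of_isIso_app _
  -- By the universal property of localization, the unit and counit of the equivalence only need to
  -- be given after precomposition with `L` and `M`, where the inverted `η` and `ε` supply them.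
  let a : (Φ ⋙ M) ⋙ Γ' ≅ L :=
    Functor.associator _ _ _ ≪≫
      Functor.isoWhiskerLeft Φ (Localization.Lifting.iso M N'.trW (Γ ⋙ L) Γ') ≪≫
      (Functor.associator _ _ _).symm ≪≫
      (asIso (Functor.whiskerRight η L)).symm ≪≫ Functor.leftUnitor L
  let b : (Γ ⋙ L) ⋙ Φ' ≅ M :=
    Functor.associator _ _ _ ≪≫
      Functor.isoWhiskerLeft Γ (Localization.Lifting.iso L N.trW (Φ ⋙ M) Φ') ≪≫
      (Functor.associator _ _ _).symm ≪≫
      asIso (Functor.whiskerRight ε M) ≪≫ Functor.leftUnitor M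
  exact ⟨Localization.equivalence L N.trW M N'.trW (Φ ⋙ M) Φ' (Γ ⋙ L) Γ' a b,
    ⟨Localization.Lifting.iso L N.trW (Φ ⋙ M) Φ'⟩,
    ⟨Localization.Lifting.iso M N'.trW (Γ ⋙ L) Γ'⟩,
    isTriangleFunctor_of_lifting Φ Φ', isTriangleFunctor_of_lifting Γ Γ'⟩

/-- Exact functors related by a monomorphic unit with projective cokernels and an epimorphic counit
with projective kernels induce triangle equivalences between Verdier quotients. -/
lemma induceTriangleEquivalence_boundedComplexesIn
    {F : A ⥤ B} [F.Additive] [PreservesFiniteLimits F] [PreservesFiniteColimits F]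
    {G : B ⥤ A} [G.Additive] [PreservesFiniteLimits G] [PreservesFiniteColimits G]
    {η : 𝟭 A ⟶ F ⋙ G} {ε : G ⋙ F ⟶ 𝟭 B}
    (hη : ∀ X, Mono (η.app X)) (hε : ∀ Y, Epi (ε.app Y))
    (hη' : ∀ X, Projective (cokernel (η.app X))) (hε' : ∀ Y, Projective (kernel (ε.app Y)))
    {S : ObjectProperty A} {T : ObjectProperty B}
    (hS : ∀ X, Projective X → S X) (hT : ∀ Y, Projective Y → T Y)
    (hF : ∀ X, S X → T (F.obj X)) (hG : ∀ Y, T Y → S (G.obj Y)) :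
    InduceTriangleEquivalence (verdierProj (boundedComplexesIn A S))
      (verdierProj (boundedComplexesIn B T)) (verdierTriangles (boundedComplexesIn A S))
      (verdierTriangles (boundedComplexesIn B T)) (mapBounded F) (mapBounded G) := by
  obtain ⟨σ, hσ⟩ := exists_boundedUnit η hη hη' hS
  obtain ⟨ρ, hρ⟩ := exists_boundedCounit ε hε hε' hT
  exact induceTriangleEquivalence_verdier (mapBounded F) (mapBounded G)
    (boundedComplexesIn_mapBounded F hF) (boundedComplexesIn_mapBounded G hG) σ hσ ρ hρ

end

end FrobeniusGorenstein

end

/-! ### The three equivalences for a Frobenius pair -/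

open FrobeniusGorenstein in
theorem corollary4p3
    {A : Type u₁} [Category.{v₁} A] [Abelian A] [EnoughProjectives A] [HasDerivedCategory.{w₁} A]
    {B : Type u₂} [Category.{v₂} B] [Abelian B] [EnoughProjectives B] [HasDerivedCategory.{w₂} B]
    (F : A ⥤ B) (G : B ⥤ A) (α : A ≌ A) (β : B ≌ B) (h : FrobeniusPair F G α β)
    (hF : F.Faithful) (hG : G.Faithful)
    (hη : ∀ X : A, Projective (cokernel (h.adj.unit.app X)))
    (hε : ∀ Y : B, Projective (kernel (h.adj.counit.app Y))) :
    InduceTriangleEquivalence (stableProj A) (stableProj B)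
      (stableTriangles A) (stableTriangles B) h.gpLeft h.gpRight ∧
    InduceTriangleEquivalence (singularityProj A) (singularityProj B)
      (singularityTriangles A) (singularityTriangles B) h.boundedLeft h.boundedRight ∧
    InduceTriangleEquivalence (defectProj A) (defectProj B)
      (defectTriangles A) (defectTriangles B) h.boundedLeft h.boundedRight := by
  have := h.additive_left
  have := h.additive_right
  have := h.preservesFiniteLimits_left
  have := h.preservesFiniteColimits_left
  have := h.preservesFiniteLimits_right
  have := h.preservesFiniteColimits_right
  -- Faithfulness enters here: a left adjoint is faithful exactly when its unit is monic, a right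
  -- adjoint exactly when its counit is epic.
  have hη₀ (X : A) : Mono (h.adj.unit.app X) := inferInstance
  have hε₀ (Y : B) : Epi (h.adj.counit.app Y) := inferInstance
  -- The right adjoint `βFα` of `G` must preserve projectives for `G` to preserve total acyclicity.
  have hR (X : A) (hX : Projective X) :
      Projective ((α.functor ⋙ F ⋙ β.functor).obj X) :=
    β.map_projective_iff _ |>.2 (h.projective_left _ (α.map_projective_iff X |>.2 hX))
  exact ⟨induceTriangleEquivalence_stable h.adj h.projective_left h.projective_right h.adj'
      h.projective_right hR h.adj.unit h.adj.counit hη₀ hε₀ hη hε,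
    induceTriangleEquivalence_boundedComplexesIn hη₀ hε₀ hη hε (fun _ hX => hX) (fun _ hY => hY)
      h.projective_left h.projective_right,
    induceTriangleEquivalence_boundedComplexesIn hη₀ hε₀ hη hε
      gorensteinProjective_of_projective gorensteinProjective_of_projective
      (map_gorensteinProjective h.adj h.projective_left h.projective_right)
      (map_gorensteinProjective h.adj' h.projective_right hR)⟩
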